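/- Let $k \ge 4$ be an integer with $k \equiv 2 \pmod 4$. Let $B_k$ be the $k$-th Bernoulli number, $\sigma_{k-1}(n) = \sum_{d \mid n} d^{k-1}$, and let $$E_k(q) = 1 - \frac{2k}{B_k}\sum_{n=1}^{\infty} \sigma_{k-1}(n)\, q^n \qquad (|q|<1)$$ be the $q$-expansion of the Eisenstein series of weight $k$ for $\mathrm{SL}_2(\mathbb{Z})$. Let $\Theta = q\,\frac{d}{dq}$, that is, $\Theta\left(\sum_n a(n) q^n\right) = \sum_n n\,a(n)\,q^n$, and put $q_i := e^{-2\pi}$. Define the coefficients $\beta_k(n)$ by the power series expansion $$\frac{1}{E_k(q)} = \sum_{n=0}^{\infty} \beta_k(n)\, q^n .$$ Then this power series has radius of convergence exactly $q_i$, and for all complex $q$ with $|q|<q_i$ one has $E_k(q) \neq 0$ and the series converges to $1/E_k(q)$. Moreover $\beta_k(n) \neq 0$ for all $n \ge 0$, $\Theta(E_k)(q_i) \ne 0$, and $$\beta_k(n) \sim -\frac{1}{\Theta(E_k)(q_i)}\, q_i^{-n} \qquad (n \to \infty).$$ -/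

import Mathlib

open Filter Asymptotics
open scoped ENNReal ArithmeticFunction.sigma

noncomputable section

/-- The `q`-expansion `1 - (2k / B_k) ∑_{n ≥ 1} σ_{k-1}(n) q^n` of the Eisenstein series of
weight `k` for the full modular group, as a formal power series. -/
def eisensteinSeriesQ (k : ℕ) : PowerSeries ℂ :=
  PowerSeries.mk fun n =>
    if n = 0 then 1 else -(2 * (k : ℂ) / ((bernoulli k : ℚ) : ℂ)) * (σ (k - 1) n : ℂ)

/-- The value at `q` of (the sum of) a power series. -/
def powerSeriesValue (f : PowerSeries ℂ) (q : ℂ) : ℂ :=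
  ∑' n : ℕ, PowerSeries.coeff n f * q ^ n

/-- The operator `Θ = q d/dq` on power series. -/
def ramanujanTheta (f : PowerSeries ℂ) : PowerSeries ℂ :=
  PowerSeries.mk fun n => (n : ℂ) * PowerSeries.coeff n f

/-- The coefficients `β_k(n)` of the reciprocal of the Eisenstein series of weight `k`. -/
def reciprocalCoeff (k n : ℕ) : ℂ :=
  PowerSeries.coeff n (eisensteinSeriesQ k)⁻¹

/-- The point `q_i = e^{2πi·i} = e^{-2π}`. -/
def qI : ℝ := Real.exp (-2 * Real.pi)

/-- The power series above is invertible, so that its inverse is a genuine reciprocal. -/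
theorem eisensteinSeriesQ_mul_inv (k : ℕ) :
    eisensteinSeriesQ k * (eisensteinSeriesQ k)⁻¹ = 1 := by
  apply PowerSeries.mul_inv_cancel
  rw [← PowerSeries.coeff_zero_eq_constantCoeff_apply]
  simp [eisensteinSeriesQ]

/-- The series of `Θ(E_k)` converges in the unit disc. -/
theorem summable_ramanujanTheta_eisensteinSeriesQ (k : ℕ) {q : ℂ} (hq : ‖q‖ < 1) :
    Summable fun n : ℕ =>
      PowerSeries.coeff n (ramanujanTheta (eisensteinSeriesQ k)) * q ^ n := by
  have h := (summable_norm_pow_mul_geometric_of_norm_lt_one (k - 1 + 2) hq).mul_left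
    ‖2 * (k : ℂ) / ((bernoulli k : ℚ) : ℂ)‖
  refine Summable.of_norm_bounded h fun n => ?_
  rcases Nat.eq_zero_or_pos n with rfl | hn
  · simp [ramanujanTheta]
  · have hs : ((σ (k - 1) n : ℕ) : ℝ) ≤ (n : ℝ) ^ (k - 1 + 1) := by
      exact_mod_cast ArithmeticFunction.sigma_le_pow_succ (k - 1) n
    simp only [ramanujanTheta, eisensteinSeriesQ, PowerSeries.coeff_mk, hn.ne', if_false, norm_mul,
      norm_neg, norm_pow, Complex.norm_natCast]
    calc _ = ‖2 * (k : ℂ) / ((bernoulli k : ℚ) : ℂ)‖ * ((n : ℝ) * (σ (k - 1) n : ℕ) * ‖q‖ ^ n) := by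
            simp only [norm_mul, norm_div, Complex.norm_natCast]; ring
      _ ≤ ‖2 * (k : ℂ) / ((bernoulli k : ℚ) : ℂ)‖ * ((n : ℝ) * (n : ℝ) ^ (k - 1 + 1) * ‖q‖ ^ n) := by
            gcongr
      _ = _ := by rw [pow_succ' (n : ℝ) (k - 1 + 1)]

/-- The series of `E_k` converges in the unit disc. -/
theorem summable_eisensteinSeriesQ (k : ℕ) {q : ℂ} (hq : ‖q‖ < 1) :
    Summable fun n : ℕ => PowerSeries.coeff n (eisensteinSeriesQ k) * q ^ n := by
  rw [← summable_nat_add_iff 1]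
  refine Summable.of_norm_bounded
    ((summable_nat_add_iff 1).2 (summable_ramanujanTheta_eisensteinSeriesQ k hq)).norm fun n => ?_
  simp only [ramanujanTheta, PowerSeries.coeff_mk, norm_mul, Complex.norm_natCast]
  gcongr
  apply le_mul_of_one_le_left (norm_nonneg _)
  exact_mod_cast Nat.succ_pos n

end

/-!
Write `E_k = 1 - P`. For `k ≡ 2 [MOD 4]` the Bernoulli number `B_k` is positive
(`bernoulli_pos_of_mod_four_eq_two`, from Euler's formula for `ζ(k)`), so all the coefficients of
`P = (2k / B_k) ∑ σ_{k-1}(n) q^n` are positive. The recursion for the coefficients of `1 / (1 - P)`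
then gives `β_k(n) > 0`, and `Θ(E_k)` is negative on `(0, 1)`.

The transformation law under `z ↦ -1/z` at the fixed point `i`, where the automorphy factor is
`i^k = -1`, gives `E_k(q_i) = 0` (`powerSeriesValue_eisensteinSeriesQ_qI`), that is `P(q_i) = 1`.
If `|q| ≤ q_i` and `P(q) = 1`, then comparing real parts term by term with `P(q_i) = 1` forces
`q = q_i`. So `q_i` is the only zero of `E_k` in the closed disc of radius `q_i`, and it is simple
because `Θ(E_k)(q_i) ≠ 0`.

The asymptotics follow from a general fact (`tendsto_coeff_inv_mul_pow`): if `F` is holomorphic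
in a neighbourhood of the closed disc of radius `ρ` and its only zero there is a simple one at `ρ`,
then `H(z) = (z - ρ) / F(z)` is holomorphic on a larger disc, so its power series converges at `ρ`,
to `1 / F'(ρ)`. The formal identity `H = (X - ρ) F⁻¹` makes the partial sums at `ρ` telescope to
`-ρ ^ (n + 1)` times the `n`-th coefficient of `F⁻¹`. The radius of convergence is then the limit
of the ratios of consecutive coefficients, and the Cauchy product identifies the sum of the
reciprocal series.
-/

open scoped Topology ComplexOrder
open Metric

/-! ### Values of power series -/

theorem hasSum_coeff_mul {F G : PowerSeries ℂ} {z a b : ℂ}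
    (hF : HasSum (fun n => PowerSeries.coeff n F * z ^ n) a)
    (hG : HasSum (fun n => PowerSeries.coeff n G * z ^ n) b) :
    HasSum (fun n => PowerSeries.coeff n (F * G) * z ^ n) (a * b) := by
  have h := tsum_mul_tsum_eq_tsum_sum_antidiagonal_of_summable_norm hF.summable.norm
    hG.summable.norm
  have hs := (summable_norm_sum_mul_antidiagonal_of_summable_norm hF.summable.norm
    hG.summable.norm).of_norm
  rw [hF.tsum_eq, hG.tsum_eq] at h
  rw [h]
  refine hs.hasSum.congr_fun fun n => ?_
  rw [PowerSeries.coeff_mul, Finset.sum_mul]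
  refine Finset.sum_congr rfl fun x hx => ?_
  rw [← Finset.HasAntidiagonal.mem_antidiagonal.1 hx, pow_add]
  ring

theorem powerSeries_eq_of_hasSum {F G : PowerSeries ℂ} {s : ℂ → ℂ} {r : ℝ} (hr : 0 < r)
    (hF : ∀ z, ‖z‖ < r → HasSum (fun n => PowerSeries.coeff n F * z ^ n) (s z))
    (hG : ∀ z, ‖z‖ < r → HasSum (fun n => PowerSeries.coeff n G * z ^ n) (s z)) : F = G := by
  have key : ∀ F : PowerSeries ℂ,
      (∀ z, ‖z‖ < r → HasSum (fun n => PowerSeries.coeff n F * z ^ n) (s z)) →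
      HasFPowerSeriesAt s
        (FormalMultilinearSeries.ofScalars ℂ fun n => PowerSeries.coeff n F) 0 := by
    intro F hF
    rw [hasFPowerSeriesAt_iff]
    filter_upwards [ball_mem_nhds (0 : ℂ) hr] with z hz
    simpa [FormalMultilinearSeries.coeff_ofScalars, mul_comm] using hF z (by simpa using hz)
  have h := (key F hF).eq_formalMultilinearSeries (key G hG)
  ext n
  simpa [FormalMultilinearSeries.coeff_ofScalars] using
    congrArg (fun p => FormalMultilinearSeries.coeff p n) h

/-- Term-by-term differentiation; summability of `Θ F` on the disc is what bounds the
differentiated series. -/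
theorem hasDerivAt_powerSeriesValue {F : PowerSeries ℂ}
    (hF : ∀ z : ℂ, ‖z‖ < 1 → Summable fun n => PowerSeries.coeff n F * z ^ n)
    (hT : ∀ z : ℂ, ‖z‖ < 1 → Summable fun n => PowerSeries.coeff n (ramanujanTheta F) * z ^ n)
    {q : ℂ} (hq : ‖q‖ < 1) :
    HasDerivAt (powerSeriesValue F) (∑' n : ℕ, PowerSeries.coeff n F * (n * q ^ (n - 1))) q := by
  obtain ⟨r, hqr, hr1⟩ := exists_between hq
  have hr0 : 0 < r := (norm_nonneg q).trans_lt hqr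
  have hu : Summable fun n : ℕ => ‖PowerSeries.coeff n F‖ * (n * r ^ (n - 1)) := by
    have h := (hT (r : ℂ) (by simpa [abs_of_pos hr0] using hr1)).norm.mul_right r⁻¹
    refine h.congr fun n => ?_
    rcases n with _ | n
    · simp [ramanujanTheta]
    · simp only [ramanujanTheta, PowerSeries.coeff_mk, norm_mul, Complex.norm_natCast, norm_pow,
        Complex.norm_real, Real.norm_eq_abs, abs_of_pos hr0, Nat.add_sub_cancel]
      field_simp
      ring
  refine hasDerivAt_tsum_of_isPreconnected (t := ball (0 : ℂ) r) hu isOpen_ball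
    (convex_ball _ _).isPreconnected (fun n y _ => (hasDerivAt_pow n y).const_mul _)
    (fun n y hy => ?_) (mem_ball_self hr0) (hF 0 (by simp)) (by simpa using hqr)
  have hy' : ‖y‖ ≤ r := by simpa using (mem_ball_zero_iff.1 hy).le
  simp only [norm_mul, Complex.norm_natCast, norm_pow]
  gcongr

theorem powerSeriesValue_ramanujanTheta {F : PowerSeries ℂ}
    (hF : ∀ z : ℂ, ‖z‖ < 1 → Summable fun n => PowerSeries.coeff n F * z ^ n)
    (hT : ∀ z : ℂ, ‖z‖ < 1 → Summable fun n => PowerSeries.coeff n (ramanujanTheta F) * z ^ n)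
    {q : ℂ} (hq : ‖q‖ < 1) :
    powerSeriesValue (ramanujanTheta F) q = q * deriv (powerSeriesValue F) q := by
  rw [(hasDerivAt_powerSeriesValue hF hT hq).deriv, ← tsum_mul_left]
  refine tsum_congr fun n => ?_
  rcases n with _ | n
  · simp [ramanujanTheta]
  · simp only [ramanujanTheta, PowerSeries.coeff_mk, Nat.add_sub_cancel]
    ring

/-! ### Reciprocals with one dominant simple pole -/

/-- If the only zero of `F` in the closed disc of radius `ρ` is a simple zero at `ρ`, then the
coefficients of `F⁻¹` are asymptotic to those of the polar part `(F'(ρ) (z - ρ))⁻¹`. -/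
theorem tendsto_coeff_inv_mul_pow {F : PowerSeries ℂ} {ρ r : ℝ} (hρ : 0 < ρ) (hρr : ρ < r)
    (hinv : F * F⁻¹ = 1)
    (hF : ∀ z : ℂ, ‖z‖ < r → Summable fun n => PowerSeries.coeff n F * z ^ n)
    (hd : DifferentiableOn ℂ (powerSeriesValue F) (ball 0 r))
    (h0 : powerSeriesValue F ρ = 0) (h1 : deriv (powerSeriesValue F) ρ ≠ 0)
    (hne : ∀ z : ℂ, ‖z‖ ≤ ρ → z ≠ ρ → powerSeriesValue F z ≠ 0) :
    Tendsto (fun n => PowerSeries.coeff n F⁻¹ * (ρ : ℂ) ^ (n + 1)) atTop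
      (𝓝 (-(deriv (powerSeriesValue F) ρ)⁻¹)) := by
  set f := powerSeriesValue F
  set g := dslope f (ρ : ℂ)
  have hnρ : ‖(ρ : ℂ)‖ = ρ := by simp [abs_of_pos hρ]
  have hgd : DifferentiableOn ℂ g (ball 0 r) :=
    (Complex.differentiableOn_dslope (isOpen_ball.mem_nhds (by rwa [mem_ball_zero_iff, hnρ]))).2 hd
  have hfg : ∀ z, (z - ρ) * g z = f z := fun z => by
    simpa [h0] using sub_smul_dslope f (ρ : ℂ) z
  -- By compactness `g` has no zero on some disc of radius larger than `ρ`.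
  obtain ⟨R, hρR, hR⟩ : ∃ R, ρ < R ∧ ball (0 : ℂ) R ⊆ ball 0 r ∩ g ⁻¹' {0}ᶜ := by
    have hopen : IsOpen (ball (0 : ℂ) r ∩ g ⁻¹' {0}ᶜ) :=
      hgd.continuousOn.isOpen_inter_preimage isOpen_ball isOpen_compl_singleton
    have hsub : closedBall (0 : ℂ) ρ ⊆ ball (0 : ℂ) r ∩ g ⁻¹' {0}ᶜ := by
      intro z hz
      have hz' : ‖z‖ ≤ ρ := by simpa using hz
      refine ⟨by simpa using hz'.trans_lt hρr, ?_⟩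
      by_cases hzρ : z = ρ
      · simpa [g, hzρ, dslope_same] using h1
      · intro hgz
        apply hne z hz' hzρ
        rw [← hfg z, show g z = 0 from hgz, mul_zero]
    obtain ⟨δ, hδ, hδs⟩ := (isCompact_closedBall (0 : ℂ) ρ).exists_thickening_subset_open hopen hsub
    rw [thickening_closedBall hδ hρ.le] at hδs
    exact ⟨δ + ρ, by linarith, hδs⟩
  have hhd : DifferentiableOn ℂ (fun z => (g z)⁻¹) (ball 0 R) :=
    (hgd.mono fun z hz => (hR hz).1).inv fun z hz => (hR hz).2
  set H : PowerSeries ℂ :=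
    PowerSeries.mk fun n => (n.factorial : ℂ)⁻¹ * iteratedDeriv n (fun z => (g z)⁻¹) 0
  have hH : ∀ z : ℂ, ‖z‖ < R → HasSum (fun n => PowerSeries.coeff n H * z ^ n) (g z)⁻¹ := by
    intro z hz
    have h := Complex.hasSum_taylorSeries_on_ball hhd (z := z) (by simpa using hz)
    refine h.congr_fun fun n => ?_
    simp only [H, PowerSeries.coeff_mk, smul_eq_mul, sub_zero]
    ring
  have hXs : ∀ z : ℂ, HasSum
      (fun n => PowerSeries.coeff n (PowerSeries.X - PowerSeries.C (ρ : ℂ)) * z ^ n) (z - ρ) := by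
    intro z
    have h := hasSum_sum_of_ne_finset_zero (s := Finset.range 2)
      (L := SummationFilter.unconditional ℕ)
      (f := fun n => PowerSeries.coeff n (PowerSeries.X - PowerSeries.C (ρ : ℂ)) * z ^ n) (by
        intro n hn
        have hn' : 2 ≤ n := by simpa [Nat.lt_iff_add_one_le] using hn
        simp [PowerSeries.coeff_X, PowerSeries.coeff_C, show n ≠ 1 by lia, show n ≠ 0 by lia])
    convert h using 1
    simp [Finset.sum_range_succ, PowerSeries.coeff_X, PowerSeries.coeff_C]
    ring
  have hHF : F * H = PowerSeries.X - PowerSeries.C (ρ : ℂ) := by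
    refine powerSeries_eq_of_hasSum (hρ.trans hρR) (s := fun z => z - ρ) (fun z hz => ?_)
      fun z _ => hXs z
    have hz' := hR (mem_ball_zero_iff.2 hz)
    have h := hasSum_coeff_mul (hF z (by simpa using hz'.1)).hasSum (hH z hz)
    rwa [show (∑' n, PowerSeries.coeff n F * z ^ n) = (z - ρ) * g z from (hfg z).symm,
      mul_assoc, mul_inv_cancel₀ hz'.2, mul_one] at h
  have hHinv : H = (PowerSeries.X - PowerSeries.C (ρ : ℂ)) * F⁻¹ := by
    rw [← hHF, mul_right_comm, hinv, one_mul]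
  have hpartial : ∀ n, ∑ j ∈ Finset.range (n + 1), PowerSeries.coeff j H * (ρ : ℂ) ^ j =
      -(PowerSeries.coeff n F⁻¹ * (ρ : ℂ) ^ (n + 1)) := by
    intro n
    induction n with
    | zero => simp [hHinv, sub_mul]; ring
    | succ n ih =>
      rw [Finset.sum_range_succ, ih, hHinv, sub_mul, map_sub, PowerSeries.coeff_succ_X_mul,
        PowerSeries.coeff_C_mul]
      ring
  have hlim := ((hH ρ (by rwa [hnρ])).tendsto_sum_nat.comp (tendsto_add_atTop_nat 1)).neg
  rw [show g ρ = deriv f ρ from dslope_same f _] at hlim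
  refine hlim.congr fun n => ?_
  rw [Function.comp_apply, hpartial, neg_neg]

/-! ### The Eisenstein series -/

/-- Euler's formula for `ζ(k)` gives the sign `(-1) ^ (k / 2 + 1)` of `B_k`. -/
theorem bernoulli_pos_of_mod_four_eq_two {k : ℕ} (hk : k ≡ 2 [MOD 4]) : 0 < bernoulli k := by
  obtain ⟨m, rfl⟩ : ∃ m, k = 2 * (2 * m + 1) := ⟨k / 4, by unfold Nat.ModEq at hk; lia⟩
  have h := hasSum_zeta_nat (k := 2 * m + 1) (by lia)
  have hpos := hasSum_lt (i := 1) (f := fun _ : ℕ => (0 : ℝ)) (fun n => by positivity)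
    (by simp) hasSum_zero h
  rw [show (-1 : ℝ) ^ (2 * m + 1 + 1) = 1 from Even.neg_one_pow ⟨m + 1, by ring⟩, one_mul] at hpos
  by_contra! hle
  have hle' : ((bernoulli (2 * (2 * m + 1)) : ℚ) : ℝ) ≤ 0 := by exact_mod_cast hle
  refine hpos.not_ge (div_nonpos_of_nonpos_of_nonneg ?_ (by positivity))
  exact mul_nonpos_of_nonneg_of_nonpos (by positivity) hle'

theorem qI_pos : 0 < qI := Real.exp_pos _

theorem qI_lt_one : qI < 1 := by
  rw [qI, Real.exp_lt_one_iff]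
  linarith [Real.pi_pos]

theorem norm_qI : ‖(qI : ℂ)‖ = qI := by simp [abs_of_pos qI_pos]

/-- For `k ≡ 2 [MOD 4]` the modular form `E_k` vanishes at `i`. -/
theorem E_I_eq_zero {k : ℕ} (hk : 3 ≤ k) (hk4 : k ≡ 2 [MOD 4]) :
    ModularForm.E hk UpperHalfPlane.I = 0 := by
  have hS : ModularForm.E hk (ModularGroup.S • UpperHalfPlane.I) = _ :=
    SlashInvariantForm.slash_action_eqn' (ModularForm.E hk)
      (MonoidHom.mem_range.2 ⟨ModularGroup.S, rfl⟩) UpperHalfPlane.I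
  have hfix : ModularGroup.S • UpperHalfPlane.I = UpperHalfPlane.I := by
    rw [UpperHalfPlane.modular_S_smul]
    ext
    simp
  -- The automorphy factor at `i` is `i ^ k = -1`.
  have hI : (Complex.I : ℂ) ^ k = -1 := by
    obtain ⟨m, rfl⟩ : ∃ m, k = 2 * (2 * m + 1) := ⟨k / 4, by unfold Nat.ModEq at hk4; lia⟩
    rw [pow_mul, Complex.I_sq, Odd.neg_one_pow ⟨m, rfl⟩]
  have h10 : ((Matrix.SpecialLinearGroup.mapGL ℝ ModularGroup.S) 1 0 : ℝ) = 1 := by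
    rw [Matrix.SpecialLinearGroup.mapGL_coe_matrix]
    simp [Matrix.SpecialLinearGroup.map_apply_coe, ModularGroup.coe_S]
  have h11 : ((Matrix.SpecialLinearGroup.mapGL ℝ ModularGroup.S) 1 1 : ℝ) = 0 := by
    rw [Matrix.SpecialLinearGroup.mapGL_coe_matrix]
    simp [Matrix.SpecialLinearGroup.map_apply_coe, ModularGroup.coe_S]
  rw [hfix, h10, h11] at hS
  simp only [UpperHalfPlane.coe_I, Complex.ofReal_one, Complex.ofReal_zero, one_mul, add_zero,
    zpow_natCast, hI, neg_mul] at hS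
  exact CharZero.eq_neg_self_iff.1 hS

theorem powerSeriesValue_eisensteinSeriesQ_qI {k : ℕ} (hk : 3 ≤ k) (hk4 : k ≡ 2 [MOD 4]) :
    powerSeriesValue (eisensteinSeriesQ k) qI = 0 := by
  have hk2 : Even k := by
    unfold Nat.ModEq at hk4
    exact ⟨k / 2, by lia⟩
  have hq : Complex.exp (2 * Real.pi * Complex.I * (UpperHalfPlane.I : ℂ)) = qI := by
    rw [qI, Complex.ofReal_exp, UpperHalfPlane.coe_I, mul_assoc, Complex.I_mul_I]
    push_cast
    ring_nf
  have h := EisensteinSeries.q_expansion_bernoulli hk hk2 UpperHalfPlane.I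
  simp only [E_I_eq_zero hk hk4, hq, zpow_natCast] at h
  rw [tsum_pnat_eq_tsum_succ (f := fun n => (σ (k - 1) n : ℂ) * (qI : ℂ) ^ n), ← tsum_mul_left] at h
  have hs := summable_eisensteinSeriesQ k (norm_qI.trans_lt qI_lt_one)
  rw [powerSeriesValue, hs.tsum_eq_zero_add, h, sub_eq_add_neg, ← tsum_neg]
  congr 1
  · simp [eisensteinSeriesQ]
  · refine tsum_congr fun n => ?_
    simp [eisensteinSeriesQ, mul_assoc]

/-- The coefficient `(2k / B_k) σ_{k-1}(n + 1)` of `q ^ (n + 1)` in `1 - E_k`, as a real number. -/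
noncomputable def eisensteinTailCoeff (k n : ℕ) : ℝ := 2 * k / (bernoulli k : ℝ) * (σ (k - 1) (n + 1) : ℝ)

theorem eisensteinTailCoeff_pos {k : ℕ} (hk : 0 < k) (hk4 : k ≡ 2 [MOD 4]) (n : ℕ) :
    0 < eisensteinTailCoeff k n := by
  have hB : (0 : ℝ) < (bernoulli k : ℝ) := by exact_mod_cast bernoulli_pos_of_mod_four_eq_two hk4
  have hσ : (0 : ℝ) < (σ (k - 1) (n + 1) : ℝ) := by
    exact_mod_cast ArithmeticFunction.sigma_pos _ _ n.succ_ne_zero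
  unfold eisensteinTailCoeff
  positivity

theorem coeff_succ_eisensteinSeriesQ (k n : ℕ) :
    PowerSeries.coeff (n + 1) (eisensteinSeriesQ k) = -(eisensteinTailCoeff k n : ℂ) := by
  simp [eisensteinSeriesQ, eisensteinTailCoeff]

theorem coeff_zero_eisensteinSeriesQ (k : ℕ) :
    PowerSeries.coeff 0 (eisensteinSeriesQ k) = 1 := by
  simp [eisensteinSeriesQ]

theorem hasSum_eisensteinTailCoeff (k : ℕ) {q : ℂ} (hq : ‖q‖ < 1) :
    HasSum (fun n => (eisensteinTailCoeff k n : ℂ) * q ^ (n + 1))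
      (1 - powerSeriesValue (eisensteinSeriesQ k) q) := by
  have h := ((hasSum_nat_add_iff' 1).2 (summable_eisensteinSeriesQ k hq).hasSum).neg
  simp only [coeff_succ_eisensteinSeriesQ, coeff_zero_eisensteinSeriesQ, Finset.sum_range_one,
    pow_zero, mul_one, neg_mul, neg_neg, neg_sub] at h
  exact h

/-- On the closed disc of radius `q_i` the series `E_k` vanishes only at `q_i`: elsewhere the
real part of the positive series `1 - E_k` is smaller than its value `1` at `q_i`. -/
theorem powerSeriesValue_eisensteinSeriesQ_ne_zero {k : ℕ} (hk : 3 ≤ k) (hk4 : k ≡ 2 [MOD 4])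
    {q : ℂ} (hq : ‖q‖ ≤ qI) (hne : q ≠ qI) : powerSeriesValue (eisensteinSeriesQ k) q ≠ 0 := by
  intro h0
  have h1 := Complex.hasSum_re (hasSum_eisensteinTailCoeff k (hq.trans_lt qI_lt_one))
  have h2 := Complex.hasSum_re (hasSum_eisensteinTailCoeff k (norm_qI.trans_lt qI_lt_one))
  rw [h0] at h1
  rw [powerSeriesValue_eisensteinSeriesQ_qI hk hk4] at h2
  have hre : ∀ n, ((eisensteinTailCoeff k n : ℂ) * q ^ (n + 1)).re =
      eisensteinTailCoeff k n * (q ^ (n + 1)).re := fun n => Complex.re_ofReal_mul _ _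
  have hre' : ∀ n, ((eisensteinTailCoeff k n : ℂ) * (qI : ℂ) ^ (n + 1)).re =
      eisensteinTailCoeff k n * qI ^ (n + 1) := fun n => by
    rw [Complex.re_ofReal_mul, ← Complex.ofReal_pow, Complex.ofReal_re]
  refine (hasSum_lt (i := 0) (fun n => ?_) ?_ h1 h2).false
  · rw [hre, hre']
    refine mul_le_mul_of_nonneg_left ?_ (eisensteinTailCoeff_pos (by lia) hk4 n).le
    calc (q ^ (n + 1)).re ≤ ‖q ^ (n + 1)‖ := Complex.re_le_norm _
      _ = ‖q‖ ^ (n + 1) := norm_pow _ _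
      _ ≤ qI ^ (n + 1) := by gcongr
  · rw [hre, hre']
    refine mul_lt_mul_of_pos_left ?_ (eisensteinTailCoeff_pos (by lia) hk4 0)
    simp only [zero_add, pow_one]
    refine lt_of_le_of_ne ((Complex.re_le_norm q).trans hq) fun hr => hne ?_
    -- `re q = q_i ≥ ‖q‖` forces `q` to be real and nonnegative.
    have hnorm : q.re = ‖q‖ := le_antisymm (Complex.re_le_norm q) (hr ▸ hq)
    have h3 := Complex.re_eq_norm.1 hnorm
    rw [← hr]
    exact Complex.ext rfl (by simpa using (Complex.nonneg_iff.1 h3).2.symm)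

theorem reciprocalCoeff_pos {k : ℕ} (hk : 0 < k) (hk4 : k ≡ 2 [MOD 4]) (n : ℕ) :
    0 < reciprocalCoeff k n := by
  have hmul := eisensteinSeriesQ_mul_inv k
  induction n using Nat.strong_induction_on with
  | _ n ih =>
    have h := congrArg (PowerSeries.coeff n) hmul
    rw [PowerSeries.coeff_mul] at h
    rcases n with _ | n
    · rw [Finset.Nat.antidiagonal_zero, Finset.sum_singleton, coeff_zero_eisensteinSeriesQ, one_mul,
        PowerSeries.coeff_zero_one] at h
      exact (show reciprocalCoeff k 0 = 1 from h) ▸ one_pos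
    · rw [Finset.Nat.sum_antidiagonal_succ] at h
      simp only [coeff_zero_eisensteinSeriesQ, coeff_succ_eisensteinSeriesQ, one_mul, neg_mul,
        Finset.sum_neg_distrib, PowerSeries.coeff_one, n.succ_ne_zero, if_false] at h
      rw [show reciprocalCoeff k (n + 1) = _ from add_neg_eq_zero.1 h]
      refine Finset.sum_pos (fun x hx => mul_pos ?_ (ih x.2 ?_)) ⟨(0, n), by simp⟩
      · exact_mod_cast eisensteinTailCoeff_pos hk hk4 x.1
      · have := Finset.HasAntidiagonal.mem_antidiagonal.1 hx
        lia

theorem powerSeriesValue_ramanujanTheta_ne_zero {k : ℕ} (hk : 0 < k) (hk4 : k ≡ 2 [MOD 4])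
    {q : ℝ} (hq0 : 0 < q) (hq1 : q < 1) :
    powerSeriesValue (ramanujanTheta (eisensteinSeriesQ k)) q ≠ 0 := by
  intro h0
  have hs := (summable_ramanujanTheta_eisensteinSeriesQ k (q := q)
    (by simpa [abs_of_pos hq0] using hq1)).hasSum
  rw [show (∑' n, _) = (0 : ℂ) from h0] at hs
  have h1 := Complex.hasSum_re ((hasSum_nat_add_iff' 1).2 hs).neg
  have h2 : ∀ n : ℕ, (-(PowerSeries.coeff (n + 1) (ramanujanTheta (eisensteinSeriesQ k)) *
      (q : ℂ) ^ (n + 1))).re = (n + 1) * eisensteinTailCoeff k n * q ^ (n + 1) := by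
    intro n
    rw [ramanujanTheta, PowerSeries.coeff_mk, coeff_succ_eisensteinSeriesQ, ← Complex.ofReal_re
      ((n + 1) * eisensteinTailCoeff k n * q ^ (n + 1))]
    push_cast
    ring_nf
  simp only [h2] at h1
  have hpos : ∀ n : ℕ, 0 < (n + 1) * eisensteinTailCoeff k n * q ^ (n + 1) := fun n => by
    have := eisensteinTailCoeff_pos hk hk4 n
    positivity
  have := hasSum_lt (i := 0) (fun n => (hpos n).le) (hpos 0) hasSum_zero h1
  simp [ramanujanTheta] at this

theorem tendsto_reciprocalCoeff_mul_pow {k : ℕ} (hk : 3 ≤ k) (hk4 : k ≡ 2 [MOD 4]) :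
    Tendsto (fun n => reciprocalCoeff k n * (qI : ℂ) ^ n) atTop
      (𝓝 (-(1 / powerSeriesValue (ramanujanTheta (eisensteinSeriesQ k)) (qI : ℂ)))) := by
  have hF : ∀ z : ℂ, ‖z‖ < 1 → Summable _ := fun z hz => summable_eisensteinSeriesQ k hz
  have hT : ∀ z : ℂ, ‖z‖ < 1 → Summable _ :=
    fun z hz => summable_ramanujanTheta_eisensteinSeriesQ k hz
  have hθ := powerSeriesValue_ramanujanTheta hF hT (norm_qI.trans_lt qI_lt_one)
  have hθ0 := powerSeriesValue_ramanujanTheta_ne_zero (k := k) (by lia) hk4 qI_pos qI_lt_one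
  have hq0 : (qI : ℂ) ≠ 0 := by exact_mod_cast qI_pos.ne'
  have h := tendsto_coeff_inv_mul_pow qI_pos qI_lt_one (eisensteinSeriesQ_mul_inv k) hF
    (fun z hz => (hasDerivAt_powerSeriesValue hF hT
      (by simpa using hz)).differentiableAt.differentiableWithinAt)
    (powerSeriesValue_eisensteinSeriesQ_qI hk hk4) (fun h0 => hθ0 (by rw [hθ, h0, mul_zero]))
    fun z hz hne => powerSeriesValue_eisensteinSeriesQ_ne_zero hk hk4 hz hne
  convert h.div_const (qI : ℂ) using 2 with n
  · rw [reciprocalCoeff, pow_succ]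
    field_simp
  · rw [hθ, one_div, mul_inv]
    ring

theorem hasSum_reciprocalCoeff {k : ℕ} (hk : 3 ≤ k) (hk4 : k ≡ 2 [MOD 4]) {q : ℂ}
    (hq : ‖q‖ < qI) :
    HasSum (fun n : ℕ => reciprocalCoeff k n * q ^ n)
      (1 / powerSeriesValue (eisensteinSeriesQ k) q) := by
  have hne := powerSeriesValue_eisensteinSeriesQ_ne_zero hk hk4 hq.le
    (fun h => (norm_qI ▸ h ▸ hq).false)
  obtain ⟨C, hC⟩ := (tendsto_reciprocalCoeff_mul_pow hk hk4).norm.bddAbove_range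
  have hs : Summable fun n : ℕ => reciprocalCoeff k n * q ^ n := by
    refine Summable.of_norm_bounded ((summable_geometric_of_lt_one (r := ‖q‖ / qI)
      (div_nonneg (norm_nonneg _) qI_pos.le) ((div_lt_one qI_pos).2 hq)).mul_left C) fun n => ?_
    have hCn : ‖reciprocalCoeff k n * (qI : ℂ) ^ n‖ ≤ C := hC ⟨n, rfl⟩
    rw [norm_mul, norm_pow, norm_qI] at hCn
    have hp := pow_pos qI_pos n
    calc ‖reciprocalCoeff k n * q ^ n‖
        = ‖reciprocalCoeff k n‖ * qI ^ n * (‖q‖ / qI) ^ n := by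
          rw [norm_mul, norm_pow, div_pow]; field_simp
      _ ≤ C * (‖q‖ / qI) ^ n :=
          mul_le_mul_of_nonneg_right hCn
            (pow_nonneg (div_nonneg (norm_nonneg _) qI_pos.le) n)
  have h := hasSum_coeff_mul (summable_eisensteinSeriesQ k (hq.trans qI_lt_one)).hasSum hs.hasSum
  rw [eisensteinSeriesQ_mul_inv] at h
  have h1 : HasSum (fun n => PowerSeries.coeff n (1 : PowerSeries ℂ) * q ^ n) 1 := by
    convert hasSum_ite_eq (0 : ℕ) (1 : ℂ) using 2 with n
    rw [PowerSeries.coeff_one]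
    split_ifs with hn <;> simp [hn]
  convert hs.hasSum using 1
  exact (eq_div_of_mul_eq hne (by rw [mul_comm]; exact h.unique h1)).symm

theorem radius_reciprocalCoeff {k : ℕ} (hk : 3 ≤ k) (hk4 : k ≡ 2 [MOD 4]) :
    (FormalMultilinearSeries.ofScalars ℂ (reciprocalCoeff k)).radius = ENNReal.ofReal qI := by
  have hθ0 := powerSeriesValue_ramanujanTheta_ne_zero (k := k) (by lia) hk4 qI_pos qI_lt_one
  refine FormalMultilinearSeries.ofScalars_radius_eq_of_tendsto ℂ _ (r := qI.toNNReal)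
    (by simpa using qI_pos) ?_
  rw [Real.coe_toNNReal _ qI_pos.le]
  have h := (tendsto_reciprocalCoeff_mul_pow hk hk4).norm
  have hc := h.div (h.comp (tendsto_add_atTop_nat 1)) (by simpa using hθ0)
  rw [div_self (by simpa using hθ0)] at hc
  have hc' := hc.mul_const qI
  rw [one_mul] at hc'
  refine hc'.congr fun n => ?_
  have hb : ‖reciprocalCoeff k (n + 1)‖ ≠ 0 :=
    norm_ne_zero_iff.2 (reciprocalCoeff_pos (by lia) hk4 _).ne'
  have hq := qI_pos.ne'
  simp only [Pi.div_apply, Function.comp_apply, norm_mul, norm_pow, norm_qI, Nat.succ_eq_add_one,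
    pow_succ]
  field_simp

theorem theorem1 (k : ℕ) (hk : 4 ≤ k) (hk4 : k ≡ 2 [MOD 4]) :
    (FormalMultilinearSeries.ofScalars ℂ (reciprocalCoeff k)).radius = ENNReal.ofReal qI ∧
    (∀ q : ℂ, ‖q‖ < qI →
      powerSeriesValue (eisensteinSeriesQ k) q ≠ 0 ∧
      HasSum (fun n : ℕ => reciprocalCoeff k n * q ^ n)
        (1 / powerSeriesValue (eisensteinSeriesQ k) q)) ∧
    (∀ n : ℕ, reciprocalCoeff k n ≠ 0) ∧
    powerSeriesValue (ramanujanTheta (eisensteinSeriesQ k)) (qI : ℂ) ≠ 0 ∧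
    IsEquivalent atTop (fun n : ℕ => reciprocalCoeff k n)
      (fun n : ℕ => -(1 / powerSeriesValue (ramanujanTheta (eisensteinSeriesQ k)) (qI : ℂ)) *
        (qI : ℂ) ^ (-(n : ℤ))) := by
  have hk3 : 3 ≤ k := by lia
  have hθ0 := powerSeriesValue_ramanujanTheta_ne_zero (k := k) (by lia) hk4 qI_pos qI_lt_one
  refine ⟨radius_reciprocalCoeff hk3 hk4, fun q hq => ⟨?_, hasSum_reciprocalCoeff hk3 hk4 hq⟩,
    fun n => (reciprocalCoeff_pos (by lia) hk4 n).ne', hθ0, ?_⟩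
  · exact powerSeriesValue_eisensteinSeriesQ_ne_zero hk3 hk4 hq.le
      (fun h => (norm_qI ▸ h ▸ hq).false)
  · have hq0 : (qI : ℂ) ≠ 0 := by exact_mod_cast qI_pos.ne'
    have hc : -(1 / powerSeriesValue (ramanujanTheta (eisensteinSeriesQ k)) (qI : ℂ)) ≠ 0 := by
      simpa using hθ0
    rw [isEquivalent_iff_tendsto_one (.of_forall fun n => mul_ne_zero hc (zpow_ne_zero _ hq0))]
    have h := (tendsto_reciprocalCoeff_mul_pow hk3 hk4).div_const
      (-(1 / powerSeriesValue (ramanujanTheta (eisensteinSeriesQ k)) (qI : ℂ)))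
    rw [div_self hc] at h
    refine h.congr fun n => ?_
    rw [Pi.div_apply, zpow_neg, zpow_natCast, ← div_div, div_right_comm, div_inv_eq_mul]
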